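/- Let $G$ be a finite group and $V$ a cyclic $\mathbb{C}G$-module, i.e. the set $\operatorname{Gen}(V)=\{v\in V : V=\mathbb{C}Gv\}$ of generators is non-empty, and let $\chi\colon G\to\mathbb{C}$, $\chi(g)=\operatorname{Tr}_V(g)$, be its character. For $v\in \operatorname{Gen}(V)$ let $\operatorname{Sym}(G,v)$ be the group of all permutations $\pi$ of the set $G$ for which there is $A\in \operatorname{GL}(V)$ with $A(gv)=\pi(g)v$ for all $g\in G$; such an $A$ is unique, and is denoted by $D_v(\pi)$. Let $\operatorname{Sym}(G,\chi)=\operatorname{Sym}(G,V)=\bigcap_{v\in \operatorname{Gen}(V)}\operatorname{Sym}(G,v)$ be the generic symmetry group. Then for every $v\in\operatorname{Gen}(V)$ the character $\widehat{\chi}$ of the representation $D_v\colon \operatorname{Sym}(G,\chi)\to \operatorname{GL}(V)$ satisfies $$\widehat{\chi}(\pi)=\frac{1}{|G|}\sum_{g\in G}\chi\bigl(g^{-1}\pi(g)\bigr)\qquad\text{for all }\pi\in \operatorname{Sym}(G,\chi).$$ (In particular, $\widehat{\chi}$ does not depend on the choice of $v$.) -/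

import Mathlib

namespace OrbitSymmetry

section

variable {k G V : Type*} [Field k] [Group G] [AddCommGroup V] [Module k V]

/-- The set `Gen(V)` of generators: those `v` whose `G`-orbit spans `V` over `k`,
that is, `V = kGv`. -/
def generators (ρ : Representation k G V) : Set V :=
  {v | Submodule.span k (Set.range fun g : G => ρ g v) = ⊤}

/-- The group `Sym(G, v)` of orbit symmetries with respect to `v`: the permutations `π` of the
set `G` for which some `A ∈ GL(V)` satisfies `A (g v) = π(g) v` for all `g`. -/
def orbitSym (ρ : Representation k G V) (v : V) : Subgroup (Equiv.Perm G) where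
  carrier := {π | ∃ A : V ≃ₗ[k] V, ∀ g : G, A (ρ g v) = ρ (π g) v}
  one_mem' := ⟨LinearEquiv.refl k V, fun _ => rfl⟩
  mul_mem' := by
    rintro π σ ⟨A, hA⟩ ⟨B, hB⟩
    refine ⟨B.trans A, fun g => ?_⟩
    rw [LinearEquiv.trans_apply, hB, hA, Equiv.Perm.mul_apply]
  inv_mem' := by
    rintro π ⟨A, hA⟩
    refine ⟨A.symm, fun g => ?_⟩
    rw [LinearEquiv.symm_apply_eq, hA]
    exact congrArg (fun x => ρ x v) (π.apply_symm_apply g).symm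

/-- The generic symmetry group `Sym(G, V)`: the intersection of the groups `Sym(G, v)` over all
generators `v` of `V`. -/
def genericSym (ρ : Representation k G V) : Subgroup (Equiv.Perm G) :=
  ⨅ v ∈ generators ρ, orbitSym ρ v

theorem genericSym_le_orbitSym (ρ : Representation k G V) {v : V} (hv : v ∈ generators ρ) :
    genericSym ρ ≤ orbitSym ρ v :=
  iInf₂_le v hv

/-- A linear map on `V` is determined by its values on the orbit of a generator. -/
theorem linearMap_ext_of_generator (ρ : Representation k G V) {v : V} (hv : v ∈ generators ρ)
    {A B : V →ₗ[k] V} (h : ∀ g : G, A (ρ g v) = B (ρ g v)) : A = B :=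
  LinearMap.ext_on_range hv h

theorem exists_linearMap_of_mem_orbitSym (ρ : Representation k G V) (v : V)
    (π : orbitSym ρ v) :
    ∃ A : V →ₗ[k] V, ∀ g : G, A (ρ g v) = ρ (π.1 g) v := by
  obtain ⟨A, hA⟩ := π.2
  exact ⟨A.toLinearMap, hA⟩

/-- For a generator `v`, the representation `D_v` of `Sym(G, v)` on `V = kGv`: `D_v(π)` is the
unique linear map with `D_v(π) (g v) = π(g) v` for all `g`. -/
noncomputable def orbitRep (ρ : Representation k G V) (v : V) (hv : v ∈ generators ρ) :
    Representation k (orbitSym ρ v) V where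
  toFun π := (exists_linearMap_of_mem_orbitSym ρ v π).choose
  map_one' := linearMap_ext_of_generator ρ hv fun g => by
    rw [(exists_linearMap_of_mem_orbitSym ρ v 1).choose_spec]
    rfl
  map_mul' π σ := linearMap_ext_of_generator ρ hv fun g => by
    rw [(exists_linearMap_of_mem_orbitSym ρ v (π * σ)).choose_spec, Module.End.mul_apply,
      (exists_linearMap_of_mem_orbitSym ρ v σ).choose_spec,
      (exists_linearMap_of_mem_orbitSym ρ v π).choose_spec]
    rfl

/-- The defining property of `D_v`. -/
theorem orbitRep_apply (ρ : Representation k G V) (v : V) (hv : v ∈ generators ρ)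
    (π : orbitSym ρ v) (g : G) : orbitRep ρ v hv π (ρ g v) = ρ (π.1 g) v :=
  (exists_linearMap_of_mem_orbitSym ρ v π).choose_spec g

/-- The restriction of `D_v` to the generic symmetry group `Sym(G, V)`. -/
noncomputable def genericRep (ρ : Representation k G V) (v : V) (hv : v ∈ generators ρ) :
    Representation k (genericSym ρ) V :=
  (orbitRep ρ v hv).comp (Subgroup.inclusion (genericSym_le_orbitSym ρ hv))

end

end OrbitSymmetry

namespace OrbitSymmetry

open Polynomial

variable {k G V : Type*} [Field k] [Group G] [AddCommGroup V] [Module k V]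

/-! The trace of `D_w(π)` does not depend on the generator `w`: along the line through two
generators it is a rational function of the parameter, yet it takes finitely many values, since
`D_w(π)` has order dividing that of `π`. Hence it is constant (`trace_eq_of_mem_genericSym`), and
the trace at `v` may be averaged over the generators `h v`. A functional supplied by Maschke's
theorem turns that average into the sum of characters (`sum_trace_orbit_eq`). -/

theorem finite_of_mem_generators [Finite G] (ρ : Representation k G V) {v : V}
    (hv : v ∈ generators ρ) : Module.Finite k V :=
  ⟨Submodule.fg_def.2 ⟨_, Set.finite_range _, hv⟩⟩

theorem apply_mem_generators (ρ : Representation k G V) {v : V} (hv : v ∈ generators ρ) (h : G) :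
    ρ h v ∈ generators ρ := by
  have hrange : (Set.range fun g : G => ρ g (ρ h v)) = Set.range fun g : G => ρ g v := by
    have hcomp : (fun g : G => ρ g (ρ h v)) = (fun g : G => ρ g v) ∘ Equiv.mulRight h := by
      ext g
      simp
    rw [hcomp, EquivLike.range_comp]
  change Submodule.span k _ = ⊤
  rw [hrange]
  exact hv

/-- The orbit of a generator contains a basis. -/
theorem exists_basis_of_mem_generators [Finite G] (ρ : Representation k G V) {v : V}
    (hv : v ∈ generators ρ) :
    ∃ (n : ℕ) (u : Fin n → G) (b : Module.Basis (Fin n) k V), ∀ i, b i = ρ (u i) v := by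
  obtain ⟨κ, a, ha, hspan, hli⟩ := exists_linearIndependent' k fun g : G => ρ g v
  have : Finite κ := Finite.of_injective a ha
  have e := Finite.equivFin κ
  refine ⟨Nat.card κ, a ∘ e.symm,
    (Module.Basis.mk hli (hspan.trans hv).ge).reindex e, fun i => ?_⟩
  simp

theorem pow_eq_one_of_mem_generators (ρ : Representation k G V) {w : V} (hw : w ∈ generators ρ)
    {π : Equiv.Perm G} {A : V →ₗ[k] V} (hA : ∀ g, A (ρ g w) = ρ (π g) w) {n : ℕ}
    (hn : π ^ n = 1) : A ^ n = 1 := by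
  have hpow : ∀ (m : ℕ) (g : G), (A ^ m) (ρ g w) = ρ ((π ^ m) g) w := by
    intro m
    induction m with
    | zero => simp
    | succ m ih =>
      intro g
      rw [pow_succ', Module.End.mul_apply, ih, hA, pow_succ', Equiv.Perm.mul_apply]
  refine linearMap_ext_of_generator ρ hw fun g => ?_
  rw [hpow, hn]
  rfl

/-- The endomorphisms whose `n`-th power is the identity have only finitely many traces. -/
theorem finite_trace_of_pow_eq_one [IsAlgClosed k] [Module.Finite k V] {n : ℕ} (hn : 0 < n) :
    {c : k | ∃ A : V →ₗ[k] V, A ^ n = 1 ∧ LinearMap.trace k V A = c}.Finite := by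
  classical
  -- Each trace is the sum of a multiset of `dim V` many `n`-th roots of unity.
  refine (((nthRoots n (1 : k)).toFinset.sym (Module.finrank k V)).image
    fun m : Sym k (Module.finrank k V) => (m : Multiset k).sum).finite_toSet.subset ?_
  rintro _ ⟨A, hA, rfl⟩
  have hsplits : A.charpoly.Splits := IsAlgClosed.splits _
  rw [Module.End.trace_eq_sum_roots_charpoly_of_splits hsplits]
  simp only [Finset.coe_image, Set.mem_image, Finset.mem_coe]
  refine ⟨Sym.mk A.charpoly.roots ?_, Finset.mem_sym_iff.2 fun c hc => ?_, rfl⟩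
  · rw [← hsplits.natDegree_eq_card_roots, LinearMap.charpoly_natDegree]
  · rw [Multiset.mem_toFinset, mem_nthRoots hn]
    have hroot : A.charpoly.IsRoot c := isRoot_of_mem_roots hc
    rw [← Module.End.hasEigenvalue_iff_isRoot_charpoly] at hroot
    obtain ⟨x, hx⟩ := hroot.exists_hasEigenvector
    have h := hx.pow_apply n
    rw [hA, Module.End.one_apply] at h
    have h' : (c ^ n - 1) • x = 0 := by rw [sub_smul, ← h, one_smul, sub_self]
    exact sub_eq_zero.1 ((smul_eq_zero.1 h').resolve_right hx.2)

/-- Along a line, the trace of the operator attached to a permutation is a rational function,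
with denominator nonvanishing at a prescribed generator. -/
theorem exists_polynomial_trace_on_line [Finite G] (ρ : Representation k G V) (π : Equiv.Perm G)
    (a d : V) (t₀ : k) (h₀ : a + t₀ • d ∈ generators ρ) :
    ∃ p q : k[X], q.eval t₀ ≠ 0 ∧
      (∀ t, q.eval t ≠ 0 → a + t • d ∈ generators ρ) ∧
      ∀ t (A : V →ₗ[k] V), (∀ g, A (ρ g (a + t • d)) = ρ (π g) (a + t • d)) →
        q.eval t * LinearMap.trace k V A = p.eval t := by
  obtain ⟨n, u, b, hb⟩ := exists_basis_of_mem_generators ρ h₀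
  let M : (Fin n → G) → Matrix (Fin n) (Fin n) k[X] := fun w =>
    Matrix.of fun i j => C (b.repr (ρ (w j) a) i) + X * C (b.repr (ρ (w j) d) i)
  have hM : ∀ (w : Fin n → G) (t : k),
      (M w).map (eval t) = b.toMatrix fun j => ρ (w j) (a + t • d) := by
    intro w t
    ext i j
    simp [M, Module.Basis.toMatrix_apply, mul_comm t]
  have hdet : ∀ t, (M u).det.eval t = b.det fun j => ρ (u j) (a + t • d) := by
    intro t
    rw [Module.Basis.det_apply, ← hM, ← coe_evalRingHom, RingHom.map_det]
    rfl
  -- In coordinates `A * M u = M (π ∘ u)` at `t`; multiplying by the adjugate clears the denominator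
  -- `det (M u)`, which is 1 at `t₀`.
  refine ⟨(M (π ∘ u) * (M u).adjugate).trace, (M u).det, ?_, fun t ht => ?_, fun t A hA => ?_⟩
  · rw [hdet, ← funext hb, b.det_self]
    exact one_ne_zero
  · rw [hdet, ← isUnit_iff_ne_zero, ← b.is_basis_iff_det] at ht
    refine top_unique (ht.2.ge.trans (Submodule.span_mono ?_))
    rintro _ ⟨j, rfl⟩
    exact ⟨u j, rfl⟩
  · have hmul : LinearMap.toMatrix b b A * (M u).map (eval t) = (M (π ∘ u)).map (eval t) := by
      rw [hM, hM]
      ext i j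
      have h := congrFun (LinearMap.toMatrix_mulVec_repr b b A (ρ (u j) (a + t • d))) i
      rw [hA] at h
      exact h
    have hadj : (M u).adjugate.map (eval t) = ((M u).map (eval t)).adjugate :=
      (evalRingHom t).map_adjugate (M u)
    have hdet' : (M u).det.eval t = ((M u).map (eval t)).det := (evalRingHom t).map_det (M u)
    have htrace : (M (π ∘ u) * (M u).adjugate).trace.eval t =
        ((M (π ∘ u)).map (eval t) * (M u).adjugate.map (eval t)).trace := by
      have h := AddMonoidHom.map_trace (evalRingHom t) (M (π ∘ u) * (M u).adjugate)
      rw [coe_evalRingHom] at h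
      rw [h, ← coe_evalRingHom, Matrix.map_mul]
    rw [htrace, hadj, ← hmul, Matrix.mul_assoc, Matrix.mul_adjugate, Matrix.mul_smul,
      Matrix.mul_one, Matrix.trace_smul, ← hdet', LinearMap.trace_eq_matrix_trace k b, smul_eq_mul]

/-- The trace of the operator attached to a generic symmetry is the same for all generators. -/
theorem trace_eq_of_mem_genericSym [IsAlgClosed k] [Finite G] (ρ : Representation k G V)
    {π : Equiv.Perm G} (hπ : π ∈ genericSym ρ) {v w : V} (hv : v ∈ generators ρ)
    (hw : w ∈ generators ρ) {A B : V →ₗ[k] V} (hA : ∀ g, A (ρ g v) = ρ (π g) v)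
    (hB : ∀ g, B (ρ g w) = ρ (π g) w) :
    LinearMap.trace k V A = LinearMap.trace k V B := by
  have := finite_of_mem_generators ρ hv
  have h0 : v + (0 : k) • (w - v) = v := by simp
  have h1 : v + (1 : k) • (w - v) = w := by simp
  obtain ⟨p, q, hq, hgen, hpq⟩ :=
    exists_polynomial_trace_on_line ρ π v (w - v) 0 (by rwa [h0])
  obtain ⟨p', q', hq', -, hpq'⟩ :=
    exists_polynomial_trace_on_line ρ π v (w - v) 1 (by rwa [h1])
  classical
  have hne : q * q' ≠ 0 := by
    refine mul_ne_zero ?_ ?_ <;> rintro rfl <;> simp at *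
  let T : Set k := {t | (q * q').eval t ≠ 0}
  have hT : T.Infinite := by
    have h : Tᶜ.Finite := by
      refine (q * q').roots.toFinset.finite_toSet.subset fun t ht => ?_
      exact Multiset.mem_toFinset.2 ((mem_roots hne).2 (not_not.1 ht))
    exact fun hfin => Set.infinite_univ (α := k) (by simpa using hfin.union h)
  have hop : ∀ t : k, ∃ D : V →ₗ[k] V, t ∈ T →
      ∀ g, D (ρ g (v + t • (w - v))) = ρ (π g) (v + t • (w - v)) := by
    intro t
    by_cases ht : t ∈ T
    · have hmem := hgen t fun h => ht (by rw [eval_mul, h, zero_mul])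
      obtain ⟨D, hD⟩ := genericSym_le_orbitSym ρ hmem hπ
      exact ⟨D.toLinearMap, fun _ => hD⟩
    · exact ⟨0, fun h => (ht h).elim⟩
  choose D hD using hop
  have hfin := finite_trace_of_pow_eq_one (k := k) (V := V) (orderOf_pos π)
  -- Pigeonhole: infinitely many parameters, finitely many traces.
  obtain ⟨c, hc⟩ : ∃ c : k, {t ∈ T | LinearMap.trace k V (D t) = c}.Infinite := by
    by_contra! h
    refine hT ((hfin.biUnion fun c _ => h c).subset fun t ht => ?_)
    refine Set.mem_biUnion (x := LinearMap.trace k V (D t)) ⟨D t, ?_, rfl⟩ ⟨ht, rfl⟩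
    exact pow_eq_one_of_mem_generators ρ
      (hgen t fun h => ht (by rw [eval_mul, h, zero_mul])) (hD t ht) (pow_orderOf_eq_one π)
  have hp : p = q * C c := eq_of_infinite_eval_eq _ _ <| hc.mono fun t ht => by
    have h := hpq t (D t) (hD t ht.1)
    rw [ht.2] at h
    simp [← h]
  have hp' : p' = q' * C c := eq_of_infinite_eval_eq _ _ <| hc.mono fun t ht => by
    have h := hpq' t (D t) (hD t ht.1)
    rw [ht.2] at h
    simp [← h]
  have hAc := hpq 0 A (by rwa [h0])
  have hBc := hpq' 1 B (by rwa [h1])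
  rw [hp, eval_mul, eval_C] at hAc
  rw [hp', eval_mul, eval_C] at hBc
  rw [mul_left_cancel₀ hq hAc, mul_left_cancel₀ hq' hBc]

/-- By Maschke's theorem, every vector is reconstructed from its coefficients with respect to the
orbit of a generator by a single linear functional. -/
theorem exists_reconstruction_functional [Fintype G] [NeZero (Fintype.card G : k)]
    (ρ : Representation k G V) {v : V} (hv : v ∈ generators ρ) :
    ∃ f : V →ₗ[k] k, ∀ w, ∑ g : G, f (ρ g⁻¹ w) • ρ g v = w := by
  have hsurj : LinearMap.range (Fintype.linearCombination k fun g : G => ρ g v) = ⊤ := by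
    rw [Fintype.range_linearCombination]
    exact hv
  obtain ⟨s, hs⟩ := LinearMap.exists_rightInverse_of_surjective _ hsurj
  have hs' : ∀ w, ∑ g : G, s w g • ρ g v = w := fun w => by
    simpa [Fintype.linearCombination_apply] using LinearMap.congr_fun hs w
  have hcard : (Fintype.card G : k) ≠ 0 := NeZero.ne _
  -- The coefficient at the identity of the section `s` averaged over `G`; equivariance gives the
  -- other coefficients.
  refine ⟨(Fintype.card G : k)⁻¹ • ∑ h : G, LinearMap.proj h ∘ₗ s ∘ₗ ρ h, fun w => ?_⟩
  have hsum : ∑ g : G, ∑ h : G, s (ρ h (ρ g⁻¹ w)) h • ρ g v = (Fintype.card G : k) • w := by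
    rw [Finset.sum_comm]
    calc ∑ h : G, ∑ g : G, s (ρ h (ρ g⁻¹ w)) h • ρ g v
        = ∑ h : G, ∑ x : G, s (ρ x w) h • ρ (x⁻¹ * h) v := by
          refine Finset.sum_congr rfl fun h _ => ?_
          refine Fintype.sum_equiv ((Equiv.inv G).trans (Equiv.mulLeft h)) _ _ fun g => ?_
          simp
      _ = ∑ x : G, ρ x⁻¹ (∑ h : G, s (ρ x w) h • ρ h v) := by
          rw [Finset.sum_comm]
          simp
      _ = (Fintype.card G : k) • w := by
          simp [hs', Nat.cast_smul_eq_nsmul]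
  calc _ = (Fintype.card G : k)⁻¹ •
        ∑ g : G, ∑ h : G, s (ρ h (ρ g⁻¹ w)) h • ρ g v := by
        simp [Finset.smul_sum, Finset.sum_smul, smul_smul]
    _ = w := by rw [hsum, inv_smul_smul₀ hcard]

/-- Reconstruction writes `A` as a sum of rank-one maps, whose traces are evaluations. -/
theorem trace_eq_sum_of_reconstruction [Fintype G] [Module.Finite k V]
    (ρ : Representation k G V) {v : V} {f : V →ₗ[k] k}
    (hf : ∀ w, ∑ g : G, f (ρ g⁻¹ w) • ρ g v = w) (A : V →ₗ[k] V) :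
    LinearMap.trace k V A = ∑ g : G, f (ρ g⁻¹ (A (ρ g v))) := by
  have hA : A = ∑ g : G, (f ∘ₗ ρ g⁻¹).smulRight (A (ρ g v)) := by
    ext w
    conv_lhs => rw [← hf w]
    simp
  conv_lhs => rw [hA]
  simp

/-- The traces of the operators attached to a permutation, averaged over the orbit of a generator,
are given by the character. -/
theorem sum_trace_orbit_eq [Fintype G] [NeZero (Fintype.card G : k)]
    (ρ : Representation k G V) {v : V} (hv : v ∈ generators ρ) (π : Equiv.Perm G)
    (A : G → V →ₗ[k] V) (hA : ∀ h g, A h (ρ g (ρ h v)) = ρ (π g) (ρ h v)) :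
    ∑ h : G, LinearMap.trace k V (A h) = ∑ g : G, ρ.character (g⁻¹ * π g) := by
  have := finite_of_mem_generators ρ hv
  obtain ⟨f, hf⟩ := exists_reconstruction_functional ρ hv
  have htrace : ∀ h, LinearMap.trace k V (A h) =
      ∑ g : G, f (ρ h⁻¹ (ρ (g⁻¹ * π g) (ρ h v))) := by
    intro h
    rw [trace_eq_sum_of_reconstruction ρ hf]
    refine Fintype.sum_equiv (Equiv.mulRight h⁻¹) _ _ fun g => ?_
    have hg : ρ g v = ρ (g * h⁻¹) (ρ h v) := by
      rw [← Module.End.mul_apply, ← map_mul, inv_mul_cancel_right]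
    rw [hg, hA]
    simp only [← Module.End.mul_apply, ← map_mul, Equiv.coe_mulRight]
    congr 3
    group
  simp_rw [htrace]
  rw [Finset.sum_comm]
  refine Finset.sum_congr rfl fun g _ => ?_
  -- For fixed `g`, the sum over `h` is again a trace expansion, with the same `f`.
  exact (trace_eq_sum_of_reconstruction ρ hf (ρ (g⁻¹ * π g))).symm

end OrbitSymmetry

theorem mainTheorem5 {G : Type*} [Group G] [Fintype G]
    {V : Type*} [AddCommGroup V] [Module ℂ V]
    (ρ : Representation ℂ G V) (χ : G → ℂ) (hχ : χ = ρ.character)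
    (v : V) (hv : v ∈ OrbitSymmetry.generators ρ)
    (π : OrbitSymmetry.genericSym ρ) :
    (OrbitSymmetry.genericRep ρ v hv).character π =
      1 / (Fintype.card G : ℂ) * ∑ g : G, χ (g⁻¹ * (π : Equiv.Perm G) g) := by
  have hD : ∀ (w : V) (hw : w ∈ OrbitSymmetry.generators ρ) (g : G),
      OrbitSymmetry.genericRep ρ w hw π (ρ g w) = ρ ((π : Equiv.Perm G) g) w := fun w hw g =>
    OrbitSymmetry.orbitRep_apply ρ w hw _ g
  have hcard : (Fintype.card G : ℂ) ≠ 0 := Nat.cast_ne_zero.2 Fintype.card_ne_zero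
  have : NeZero (Fintype.card G : ℂ) := ⟨hcard⟩
  have hgen := OrbitSymmetry.apply_mem_generators ρ hv
  have hconst : ∀ h : G, LinearMap.trace ℂ V (OrbitSymmetry.genericRep ρ (ρ h v) (hgen h) π) =
      (OrbitSymmetry.genericRep ρ v hv).character π := fun h =>
    OrbitSymmetry.trace_eq_of_mem_genericSym ρ π.2 (hgen h) hv (hD _ _) (hD _ _)
  have hsum := OrbitSymmetry.sum_trace_orbit_eq ρ hv (π : Equiv.Perm G) _ fun h => hD _ (hgen h)
  simp only [hconst, Finset.sum_const, Finset.card_univ, nsmul_eq_mul] at hsum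
  rw [hχ, ← hsum, one_div, inv_mul_cancel_left₀ hcard]
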